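/- Let $M$ and $N$ be smooth ($C^\infty$) finite-dimensional real manifolds without boundary, Hausdorff and second countable, and let $C^\infty(M)$, $C^\infty(N)$ be their unital $\mathbb{R}$-algebras of real-valued smooth functions. Let $\pi\colon C^\infty(M)\to C^\infty(N)$ be a surjective homomorphism of unital $\mathbb{R}$-algebras. Then: 1. There is a smooth map $F\colon N\to M$ such that $\pi=F^*$, i.e. $\pi(f)=f\circ F$ for all $f\in C^\infty(M)$; moreover $F$ is a proper smooth embedding (an immersion that is a homeomorphism onto its image, and a proper map), and $F(N)$ is a closed subset of $M$ that is an embedded submanifold of $M$ of dimension $\dim N$. 2. $C^\infty(N)$ is a submanifold algebra of $C^\infty(M)$ via $\pi$. That is, let $\operatorname{Der}_\pi(C^\infty(M))$ be the set of $\mathbb{R}$-linear derivations $D$ of $C^\infty(M)$ with $D(\ker\pi)\subseteq\ker\pi$, and for such $D$ let $\pi_*D$ be the unique derivation of $C^\infty(N)$ with $(\pi_*D)\circ\pi=\pi\circ D$; then the map $\pi_*\colon\operatorname{Der}_\pi(C^\infty(M))\to\operatorname{Der}(C^\infty(N))$ is surjective. Here a subset $S\subseteq M$ is an embedded submanifold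 of dimension $k$ if every $p\in S$ lies in the domain $U$ of a smooth chart $\varphi\colon U\to E$ of $M$, with $E$ the model vector space, such that $\varphi(U\cap S)=\varphi(U)\cap(\varphi(p)+L)$ for some $k$-dimensional linear subspace $L\subseteq E$. -/

import Mathlib

open scoped Manifold ContDiff

/-- The pullback `F^* : C^∞(M) → C^∞(N)`, `f ↦ f ∘ F`, along a smooth map `F : N → M`,
as a homomorphism of real unital algebras. -/
noncomputable def smoothPullback
    {E : Type*} [NormedAddCommGroup E] [NormedSpace ℝ E] {H : Type*} [TopologicalSpace H]
    {I : ModelWithCorners ℝ E H} {M : Type*} [TopologicalSpace M] [ChartedSpace H M]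
    {E' : Type*} [NormedAddCommGroup E'] [NormedSpace ℝ E'] {H' : Type*} [TopologicalSpace H']
    {J : ModelWithCorners ℝ E' H'} {N : Type*} [TopologicalSpace N] [ChartedSpace H' N]
    (F : C^∞⟮J, N; I, M⟯) : C^∞⟮I, M; ℝ⟯ →ₐ[ℝ] C^∞⟮J, N; ℝ⟯ where
  toFun f := f.comp F
  map_one' := rfl
  map_mul' _ _ := rfl
  map_zero' := rfl
  map_add' _ _ := rfl
  commutes' _ := rfl

/-- `S` is an embedded submanifold of dimension `k` of the smooth manifold `M`: around every point
`p` of `S` there is a smooth chart `φ : U → E` of `M` that flattens `S`, that is, such that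
`φ (U ∩ S) = φ U ∩ (φ p + L)` for some `k`-dimensional linear subspace `L` of `E`. -/
def IsEmbeddedSubmanifold
    {E : Type*} [NormedAddCommGroup E] [NormedSpace ℝ E] {H : Type*} [TopologicalSpace H]
    (I : ModelWithCorners ℝ E H) {M : Type*} [TopologicalSpace M] [ChartedSpace H M]
    (k : ℕ) (S : Set M) : Prop :=
  ∀ p ∈ S, ∃ φ ∈ IsManifold.maximalAtlas I ∞ M, p ∈ φ.source ∧
    ∃ L : Submodule ℝ E, Module.finrank ℝ L = k ∧
      ∀ q ∈ φ.source, q ∈ S ↔ I (φ q) - I (φ p) ∈ L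

/-- `Der_π(A)`: the derivations of `A` that map the kernel of `π : A → B` to itself. -/
def kerDerivations {K A B : Type*} [Field K] [CommRing A] [Algebra K A] [CommRing B] [Algebra K B]
    (π : A →ₐ[K] B) : LieSubalgebra K (Derivation K A A) where
  carrier := {D | ∀ a ∈ RingHom.ker π, D a ∈ RingHom.ker π}
  add_mem' {D₁ D₂} h₁ h₂ a ha := by
    rw [Derivation.add_apply]
    exact add_mem (h₁ a ha) (h₂ a ha)
  zero_mem' a _ := by simp
  smul_mem' c D h a ha := by
    have := h a ha
    rw [RingHom.mem_ker] at this ⊢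
    rw [Derivation.smul_apply, map_smul, this, smul_zero]
  lie_mem' {D₁ D₂} h₁ h₂ a ha := by
    rw [Derivation.commutator_apply]
    exact sub_mem (h₁ _ (h₂ a ha)) (h₂ _ (h₁ a ha))

theorem kerDerivations_apply_eq {K A B : Type*} [Field K] [CommRing A] [Algebra K A] [CommRing B]
    [Algebra K B] {π : A →ₐ[K] B} (D : kerDerivations π) {a b : A} (h : π a = π b) :
    π (D.1 a) = π (D.1 b) := by
  have h0 : a - b ∈ RingHom.ker π := by rw [RingHom.mem_ker, map_sub, h, sub_self]
  have h1 := D.2 _ h0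
  rwa [RingHom.mem_ker, map_sub, map_sub, sub_eq_zero] at h1

/-- For surjective `π : A → B`, the map `π_* : Der_π(A) → Der(B)`, where `π_* D` is the
derivation of `B` determined by `(π_* D) (π a) = π (D a)` for all `a : A`. -/
noncomputable def pushDerivation {K A B : Type*} [Field K] [CommRing A] [Algebra K A] [CommRing B]
    [Algebra K B] (π : A →ₐ[K] B) (hπ : Function.Surjective π) (D : kerDerivations π) :
    Derivation K B B :=
  Derivation.mk'
    { toFun := fun b => π (D.1 (Function.surjInv hπ b))
      map_add' := fun x y => by
        rw [← map_add, ← map_add]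
        apply kerDerivations_apply_eq
        simp [Function.surjInv_eq hπ]
      map_smul' := fun c x => by
        rw [RingHom.id_apply, ← map_smul, ← Derivation.map_smul]
        apply kerDerivations_apply_eq
        simp [Function.surjInv_eq hπ] }
    (fun x y => by
      change π (D.1 (Function.surjInv hπ (x * y))) =
        x • π (D.1 (Function.surjInv hπ y)) + y • π (D.1 (Function.surjInv hπ x))
      rw [kerDerivations_apply_eq D
        (b := Function.surjInv hπ x * Function.surjInv hπ y)
        (by simp [Function.surjInv_eq hπ])]
      simp [Function.surjInv_eq hπ])

theorem pushDerivation_apply {K A B : Type*} [Field K] [CommRing A] [Algebra K A] [CommRing B]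
    [Algebra K B] (π : A →ₐ[K] B) (hπ : Function.Surjective π) (D : kerDerivations π) (a : A) :
    pushDerivation π hπ D (π a) = π (D.1 a) :=
  kerDerivations_apply_eq D (Function.surjInv_eq hπ (π a))

/-- `π : A → B` is a coembedding, that is, it exhibits `B` as a submanifold algebra of `A`:
`π` is surjective, and so is `π_* : Der_π(A) → Der(B)`. -/
def IsCoembedding {K A B : Type*} [Field K] [CommRing A] [Algebra K A] [CommRing B]
    [Algebra K B] (π : A →ₐ[K] B) : Prop :=
  ∃ hπ : Function.Surjective π, Function.Surjective (pushDerivation π hπ)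

open Set Filter Topology in
/-- Differentiation under the integral sign over `[0, 1]`. -/
theorem hasFDerivAt_intervalIntegral_of_contDiff {E : Type*} [NormedAddCommGroup E]
    [NormedSpace ℝ E] [FiniteDimensional ℝ E] {f : E × ℝ → ℝ} (hf : ContDiff ℝ ∞ f) (x₀ : E) :
    HasFDerivAt (fun x => ∫ t in (0 : ℝ)..1, f (x, t))
      (∫ t in (0 : ℝ)..1, (fderiv ℝ f (x₀, t)).comp (ContinuousLinearMap.inl ℝ E ℝ)) x₀ := by
  have : ProperSpace E := FiniteDimensional.proper ℝ E
  have hcont : Continuous fun p : E × ℝ =>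
      (fderiv ℝ f p).comp (ContinuousLinearMap.inl ℝ E ℝ) :=
    (hf.continuous_fderiv (by simp)).clm_comp continuous_const
  obtain ⟨C, hC⟩ := ((isCompact_closedBall x₀ 1).prod (isCompact_Icc (a := (0 : ℝ)) (b := 1))
    ).exists_bound_of_continuousOn hcont.continuousOn
  refine intervalIntegral.hasFDerivAt_integral_of_dominated_of_fderiv_le
    (F := fun x t => f (x, t))
    (F' := fun x t => (fderiv ℝ f (x, t)).comp (ContinuousLinearMap.inl ℝ E ℝ))
    (s := Metric.closedBall x₀ 1) (bound := fun _ => C)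
    (Metric.closedBall_mem_nhds _ one_pos) ?_ ?_ ?_ ?_ ?_ ?_
  · exact Eventually.of_forall fun x =>
      (hf.continuous.comp (by fun_prop)).aestronglyMeasurable
  · exact (hf.continuous.comp (by fun_prop)).intervalIntegrable _ _
  · exact (hcont.comp (by fun_prop : Continuous fun t : ℝ => (x₀, t))).aestronglyMeasurable
  · refine Eventually.of_forall fun t ht x hx => hC (x, t) ⟨hx, ?_⟩
    rw [uIoc_of_le zero_le_one] at ht
    exact Ioc_subset_Icc_self ht
  · exact intervalIntegrable_const
  · refine Eventually.of_forall fun t _ x _ => ?_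
    exact ((hf.differentiable (by simp)) (x, t)).hasFDerivAt.comp x (hasFDerivAt_prodMk_left x t)

theorem contDiff_intervalIntegral_of_contDiff {E : Type*} [NormedAddCommGroup E]
    [NormedSpace ℝ E] [FiniteDimensional ℝ E] {f : E × ℝ → ℝ} (hf : ContDiff ℝ ∞ f) :
    ContDiff ℝ ∞ fun x => ∫ t in (0 : ℝ)..1, f (x, t) := by
  rw [contDiff_infty]
  intro n
  induction n generalizing f with
  | zero =>
    exact contDiff_zero.2 (continuous_iff_continuousAt.2 fun x =>
      (hasFDerivAt_intervalIntegral_of_contDiff hf x).continuousAt)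
  | succ n ih =>
    push_cast
    refine contDiff_succ_iff_fderiv_apply.2
      ⟨fun x => (hasFDerivAt_intervalIntegral_of_contDiff hf x).differentiableAt, by simp,
        fun y => ?_⟩
    have hcont : Continuous fun p : E × ℝ =>
        (fderiv ℝ f p).comp (ContinuousLinearMap.inl ℝ E ℝ) :=
      (hf.continuous_fderiv (by simp)).clm_comp continuous_const
    have hsmooth : ContDiff ℝ ∞ fun p : E × ℝ => fderiv ℝ f p (y, 0) :=
      (hf.fderiv_right (by simp)).clm_apply contDiff_const
    convert ih hsmooth using 2 with x
    rw [(hasFDerivAt_intervalIntegral_of_contDiff hf x).fderiv]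
    refine (ContinuousLinearMap.intervalIntegral_apply (Continuous.intervalIntegrable
      (hcont.comp (by fun_prop : Continuous fun t : ℝ => (x, t))) _ _) y).trans ?_
    simp

/-- **Hadamard's lemma**. -/
theorem ContDiff.exists_eq_add_sum_smooth_mul {E : Type*} [NormedAddCommGroup E]
    [NormedSpace ℝ E] [FiniteDimensional ℝ E] {ι : Type*} [Fintype ι] (b : Module.Basis ι ℝ E)
    {g : E → ℝ} (hg : ContDiff ℝ ∞ g) (z₀ : E) :
    ∃ h : ι → E → ℝ, (∀ j, ContDiff ℝ ∞ (h j)) ∧ (∀ j, h j z₀ = fderiv ℝ g z₀ (b j)) ∧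
      ∀ z, g z = g z₀ + ∑ j, b.repr (z - z₀) j * h j z := by
  have hsmooth : ∀ v : E, ContDiff ℝ ∞
      fun p : E × ℝ => fderiv ℝ g (z₀ + p.2 • (p.1 - z₀)) v := fun v =>
    ((hg.fderiv_right (m := ∞) (by simp)).comp (by fun_prop)).clm_apply contDiff_const
  refine ⟨fun j z => ∫ t in (0 : ℝ)..1, fderiv ℝ g (z₀ + t • (z - z₀)) (b j),
    fun j => contDiff_intervalIntegral_of_contDiff (hsmooth (b j)), fun j => by simp, fun z => ?_⟩
  have hint : ∀ v : E, Continuous fun t : ℝ => fderiv ℝ g (z₀ + t • (z - z₀)) v := fun v =>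
    (hsmooth v).continuous.comp (by fun_prop : Continuous fun t : ℝ => (z, t))
  have hFTC : ∫ t in (0 : ℝ)..1, fderiv ℝ g (z₀ + t • (z - z₀)) (z - z₀) = g z - g z₀ := by
    have hderiv : ∀ t ∈ Set.uIcc (0 : ℝ) 1, HasDerivAt (fun t : ℝ => g (z₀ + t • (z - z₀)))
        (fderiv ℝ g (z₀ + t • (z - z₀)) (z - z₀)) t := fun t _ => by
      have hline : HasDerivAt (fun t : ℝ => z₀ + t • (z - z₀)) (z - z₀) t := by
        simpa using ((hasDerivAt_id t).smul_const (z - z₀)).const_add z₀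
      exact ((hg.differentiable (by simp)) _).hasFDerivAt.comp_hasDerivAt t hline
    rw [intervalIntegral.integral_eq_sub_of_hasDerivAt hderiv ((hint _).intervalIntegrable _ _)]
    simp
  have hsum : ∀ t : ℝ, fderiv ℝ g (z₀ + t • (z - z₀)) (z - z₀) =
      ∑ j, b.repr (z - z₀) j * fderiv ℝ g (z₀ + t • (z - z₀)) (b j) := fun t => by
    generalize fderiv ℝ g (z₀ + t • (z - z₀)) = L
    conv_lhs => rw [← b.sum_repr (z - z₀)]
    simp only [map_sum, map_smul, smul_eq_mul]
  have key : g z - g z₀ =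
      ∑ j, b.repr (z - z₀) j * ∫ t in (0 : ℝ)..1, fderiv ℝ g (z₀ + t • (z - z₀)) (b j) := by
    rw [← hFTC]
    simp_rw [hsum]
    rw [intervalIntegral.integral_finsetSum fun j _ =>
      ((hint (b j)).const_mul _).intervalIntegrable _ _]
    simp
  linarith

/-- A smooth self-map with invertible derivative at a point restricts to a diffeomorphism between
neighbourhoods. -/
theorem exists_openPartialHomeomorph_of_hasFDerivAt_equiv {E : Type*} [NormedAddCommGroup E]
    [NormedSpace ℝ E] [CompleteSpace E] {f : E → E} {U : Set E} (hU : IsOpen U) {a : E} (ha : a ∈ U)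
    (hf : ContDiffOn ℝ ∞ f U) {f' : E ≃L[ℝ] E} (hf' : HasFDerivAt f (f' : E →L[ℝ] E) a) :
    ∃ e : OpenPartialHomeomorph E E, a ∈ e.source ∧ e.source ⊆ U ∧ ⇑e = f ∧
      ContDiffOn ℝ ∞ e e.source ∧ ContDiffOn ℝ ∞ e.symm e.target := by
  have hfa : ContDiffAt ℝ ∞ f a := hf.contDiffAt (hU.mem_nhds ha)
  set e₀ := hfa.toOpenPartialHomeomorph f hf' (by simp) with he₀
  have hinv : IsOpen (U ∩ fderiv ℝ f ⁻¹' Set.range ((↑) : (E ≃L[ℝ] E) → E →L[ℝ] E)) :=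
    (hf.continuousOn_fderiv_of_isOpen hU (by simp)).isOpen_inter_preimage hU
      ContinuousLinearEquiv.isOpen
  have hcoe : ⇑e₀ = f := hfa.toOpenPartialHomeomorph_coe hf' (by simp)
  refine ⟨e₀.restrOpen _ hinv, ?_, ?_, ?_, ?_, ?_⟩
  · exact ⟨hfa.mem_toOpenPartialHomeomorph_source hf' (by simp), ha, f', hf'.fderiv.symm⟩
  · exact fun x hx => hx.2.1
  · exact hcoe
  · intro x hx
    exact (hf.contDiffAt (hU.mem_nhds hx.2.1)).contDiffWithinAt.congr (fun y _ => by
      exact congrFun hcoe y) (congrFun hcoe x)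
  · intro y hy
    set e := e₀.restrOpen _ hinv
    have hx : e.symm y ∈ e.source := e.map_target hy
    obtain ⟨L, hL⟩ := hx.2.2
    have hx' : ContDiffAt ℝ ∞ f (e.symm y) := hf.contDiffAt (hU.mem_nhds hx.2.1)
    refine (e.contDiffAt_symm (f₀' := L) hy ?_ ?_).contDiffWithinAt
    · change HasFDerivAt e₀ _ _
      rw [hcoe, hL]
      exact (hx'.differentiableAt (by simp)).hasFDerivAt
    · change ContDiffAt ℝ ∞ e₀ _
      rw [hcoe]
      exact hx'

section SmoothFunctionAlgebra

open Set Filter Topology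

variable {E : Type*} [NormedAddCommGroup E] [NormedSpace ℝ E] [FiniteDimensional ℝ E]
  {H : Type*} [TopologicalSpace H] (I : ModelWithCorners ℝ E H)
  {M : Type*} [TopologicalSpace M] [T2Space M] [SigmaCompactSpace M]
  [ChartedSpace H M] [IsManifold I ∞ M]

/-- A smooth function on an open set agrees with a global smooth function near any closed subset. -/
theorem exists_contMDiffMap_eventuallyEq_nhdsSet {u : M → ℝ} {U K : Set M}
    (hU : IsOpen U) (hK : IsClosed K) (hKU : K ⊆ U) (hu : ContMDiffOn I 𝓘(ℝ) ∞ u U) :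
    ∃ f : C^∞⟮I, M; ℝ⟯, ∀ᶠ x in 𝓝ˢ K, f x = u x := by
  have := Manifold.locallyCompact_of_finiteDimensional (M := M) I
  obtain ⟨b, hb0, hb1, -⟩ := exists_contMDiffMap_zero_one_nhds_of_isClosed (n := ⊤) I
    hU.isClosed_compl hK (disjoint_left.2 fun x hx hxK => hx (hKU hxK))
  refine ⟨⟨fun x => b x * u x, fun x => ?_⟩, hb1.mono fun x hx => ?_⟩
  · by_cases hx : x ∈ U
    · exact b.contMDiff.contMDiffAt.mul (hu.contMDiffAt (hU.mem_nhds hx))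
    · have h0 : ∀ᶠ y in 𝓝 x, b y = 0 := hb0.filter_mono (nhds_le_nhdsSet hx)
      exact (contMDiffAt_const (c := (0 : ℝ))).congr_of_eventuallyEq
        (h0.mono fun y hy => by simp [hy])
  · change b x * u x = u x
    rw [hx, one_mul]

/-- A smooth function on a neighbourhood of a point has the germ of a global smooth function. -/
theorem exists_contMDiffMap_eventuallyEq_nhds {u : M → ℝ} {U : Set M}
    (hU : IsOpen U) (hu : ContMDiffOn I 𝓘(ℝ) ∞ u U) {p : M} (hp : p ∈ U) :
    ∃ f : C^∞⟮I, M; ℝ⟯, ∀ᶠ x in 𝓝 p, f x = u x := by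
  obtain ⟨f, hf⟩ := exists_contMDiffMap_eventuallyEq_nhdsSet I hU (isClosed_singleton (x := p))
    (singleton_subset_iff.2 hp) hu
  exact ⟨f, by rwa [nhdsSet_singleton] at hf⟩

/-- Smooth functions separate points from closed sets. -/
theorem exists_contMDiffMap_eq_one_of_isOpen {U : Set M} (hU : IsOpen U) {p : M} (hp : p ∈ U) :
    ∃ f : C^∞⟮I, M; ℝ⟯, f p = 1 ∧ (∀ᶠ x in 𝓝 p, f x = 1) ∧ ∀ x ∉ U, f x = 0 := by
  have := Manifold.locallyCompact_of_finiteDimensional (M := M) I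
  obtain ⟨b, hb0, hb1, -⟩ := exists_contMDiffMap_zero_one_nhds_of_isClosed (n := ⊤) I
    hU.isClosed_compl (isClosed_singleton (x := p))
    (disjoint_left.2 fun x hx hxp => hx ((mem_singleton_iff.1 hxp) ▸ hp))
  rw [nhdsSet_singleton] at hb1
  exact ⟨b, hb1.self_of_nhds, hb1, fun x hx => hb0.self_of_nhdsSet x hx⟩

variable (M) in
/-- Every σ-compact manifold has a smooth function with compact sublevel sets. -/
theorem exists_contMDiffMap_isCompact_le :
    ∃ f : C^∞⟮I, M; ℝ⟯, ∀ c : ℝ, IsCompact {x | f x ≤ c} := by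
  have := Manifold.locallyCompact_of_finiteDimensional (M := M) I
  let K : CompactExhaustion M := default
  obtain ⟨f, hf⟩ := exists_contMDiffMap_forall_mem_convex_of_local_const (n := ⊤) I
    (t := fun x : M => Ici (K.find x : ℝ)) (fun x => convex_Ici _) fun x => by
      refine ⟨(K.find x + 1 : ℕ), ?_⟩
      filter_upwards [isOpen_interior.mem_nhds
        (K.subset_interior_succ (K.find x) (K.mem_find x))] with y hy
      exact Nat.cast_le (α := ℝ).2 (K.mem_iff_find_le.1 (interior_subset hy))
  refine ⟨f, fun c => ?_⟩
  refine (K.isCompact ⌈c⌉₊).of_isClosed_subset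
    (isClosed_le f.contMDiff.continuous continuous_const) fun x hx => ?_
  refine K.mem_iff_find_le.2 ((Nat.cast_le (α := ℝ)).1 ?_)
  exact ((mem_Ici.1 (hf x)).trans hx).trans (Nat.le_ceil c)

/-- **Milnor's exercise**: characters of the algebra of smooth functions are point evaluations. -/
theorem ContMDiffMap.exists_eq_eval (χ : C^∞⟮I, M; ℝ⟯ →ₐ[ℝ] ℝ) :
    ∃ p : M, ∀ f, χ f = f p := by
  by_contra! hχ
  choose g hg using hχ
  obtain ⟨f, hf⟩ := exists_contMDiffMap_isCompact_le I M
  have hcov : ∀ p ∈ {x | f x ≤ χ f}, {x | g p x ≠ χ (g p)} ∈ 𝓝 p := fun p _ =>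
    ((isOpen_ne_fun (g p).contMDiff.continuous continuous_const).mem_nhds (hg p).symm)
  obtain ⟨t, -, ht⟩ := (hf (χ f)).elim_nhds_subcover _ hcov
  let c : ℝ → C^∞⟮I, M; ℝ⟯ := algebraMap ℝ _
  let h : C^∞⟮I, M; ℝ⟯ := (f - c (χ f)) ^ 2 + ∑ p ∈ t, (g p - c (χ (g p))) ^ 2
  have hval : ∀ x, h x = (f x - χ f) ^ 2 + ∑ p ∈ t, (g p x - χ (g p)) ^ 2 := fun x => by
    have : h x = ContMDiffMap.evalRingHom x h := rfl
    rw [this]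
    simp only [h, map_add, map_sum, map_pow, map_sub]
    rfl
  have hpos : ∀ x, h x ≠ 0 := fun x => by
    rw [hval]
    have hs : 0 ≤ ∑ p ∈ t, (g p x - χ (g p)) ^ 2 := Finset.sum_nonneg fun _ _ => sq_nonneg _
    by_cases hx : f x ≤ χ f
    · obtain ⟨p, hp, hxp⟩ := mem_iUnion₂.1 (ht hx)
      have : 0 < ∑ p ∈ t, (g p x - χ (g p)) ^ 2 :=
        Finset.sum_pos' (fun _ _ => sq_nonneg _)
          ⟨p, hp, (sq_nonneg _).lt_of_ne' (pow_ne_zero 2 (sub_ne_zero.2 hxp))⟩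
      positivity
    · have : 0 < (f x - χ f) ^ 2 := by
        have : 0 < f x - χ f := by linarith
        positivity
      positivity
  have hχ0 : χ h = 0 := by
    simp only [h, map_add, map_sum, map_pow, map_sub, c, AlgHom.commutes]
    simp
  let k : C^∞⟮I, M; ℝ⟯ := ⟨fun x => (h x)⁻¹, h.contMDiff.inv₀ hpos⟩
  have hk : h * k = 1 := by
    ext x
    exact mul_inv_cancel₀ (hpos x)
  have := congrArg χ hk
  rw [map_mul, hχ0, zero_mul, map_one] at this
  exact zero_ne_one this

variable {I}
variable {E' : Type*} [NormedAddCommGroup E'] [NormedSpace ℝ E'] {H' : Type*} [TopologicalSpace H']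
  {J : ModelWithCorners ℝ E' H'} {N : Type*} [TopologicalSpace N] [ChartedSpace H' N]

/-- A map into a manifold is smooth if it pulls smooth functions back to smooth functions. -/
theorem contMDiff_of_forall_comp {F : N → M}
    (hF : ∀ f : C^∞⟮I, M; ℝ⟯, ContMDiff J 𝓘(ℝ) ∞ (f ∘ F)) : ContMDiff J I ∞ F := by
  have hcont : Continuous F := continuous_iff_continuousAt.2 fun y => by
    refine (nhds_basis_opens (F y)).tendsto_right_iff.2 fun U ⟨hyU, hU⟩ => ?_
    obtain ⟨f, hf1, -, hf0⟩ := exists_contMDiffMap_eq_one_of_isOpen I hU hyU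
    have hne : f (F y) ≠ 0 := by simp [hf1]
    filter_upwards [(hF f).continuous.continuousAt.eventually_ne hne] with z hz
    by_contra hzU
    exact hz (hf0 _ hzU)
  intro y
  rw [contMDiffAt_iff_target]
  refine ⟨hcont.continuousAt, ?_⟩
  let e : E ≃L[ℝ] (Fin (Module.finrank ℝ E) → ℝ) := (Module.finBasis ℝ E).equivFunL
  suffices h : ContMDiffAt J 𝓘(ℝ, Fin (Module.finrank ℝ E) → ℝ) ∞
      (e ∘ extChartAt I (F y) ∘ F) y by
    have := (e.symm.contDiff (n := ∞)).contMDiff.contMDiffAt.comp y h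
    convert this using 1
    ext z
    simp
  refine contMDiffAt_pi_space.2 fun i => ?_
  have hu : ContMDiffOn I 𝓘(ℝ) ∞ (fun x => e (extChartAt I (F y) x) i)
      (chartAt H (F y)).source :=
    ((ContinuousLinearMap.proj (R := ℝ) (φ := fun _ => ℝ) i).contMDiff.comp
      e.contDiff.contMDiff).comp_contMDiffOn contMDiffOn_extChartAt
  obtain ⟨f, hf⟩ := exists_contMDiffMap_eventuallyEq_nhds I (chartAt H (F y)).open_source hu
    (mem_chart_source H (F y))
  exact ((hF f) y).congr_of_eventuallyEq
    ((hcont.continuousAt.eventually hf).mono fun z hz => hz.symm)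

/-- Algebra homomorphisms between algebras of smooth functions are pullbacks. -/
theorem exists_eq_smoothPullback (π : C^∞⟮I, M; ℝ⟯ →ₐ[ℝ] C^∞⟮J, N; ℝ⟯) :
    ∃ F : C^∞⟮J, N; I, M⟯, π = smoothPullback F := by
  have hev : ∀ y : N, ∃ p : M, ∀ f, π f y = f p := fun y => by
    let ev : C^∞⟮J, N; ℝ⟯ →ₐ[ℝ] ℝ :=
      { (ContMDiffMap.evalRingHom y : C^∞⟮J, N; ℝ⟯ →+* ℝ) with commutes' := fun _ => rfl }
    exact ContMDiffMap.exists_eq_eval I (ev.comp π)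
  choose F hF using hev
  refine ⟨⟨F, contMDiff_of_forall_comp fun f => ?_⟩, ?_⟩
  · have : f ∘ F = π f := funext fun y => (hF y f).symm
    rw [this]
    exact (π f).contMDiff
  · ext f y
    exact hF y f

end SmoothFunctionAlgebra

section SurjectivePullback

variable {E : Type*} [NormedAddCommGroup E] [NormedSpace ℝ E] {H : Type*} [TopologicalSpace H]
  {I : ModelWithCorners ℝ E H} {M : Type*} [TopologicalSpace M] [ChartedSpace H M]
  {E' : Type*} [NormedAddCommGroup E'] [NormedSpace ℝ E'] [FiniteDimensional ℝ E']
  {H' : Type*} [TopologicalSpace H'] {J : ModelWithCorners ℝ E' H'} {N : Type*}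
  [TopologicalSpace N] [ChartedSpace H' N] [T2Space N] [SigmaCompactSpace N] [IsManifold J ∞ N]

theorem injective_of_surjective_smoothPullback {F : C^∞⟮J, N; I, M⟯}
    (hF : Function.Surjective (smoothPullback F)) : Function.Injective F := by
  intro x y hxy
  by_contra hne
  obtain ⟨f, hf1, -, hf0⟩ := exists_contMDiffMap_eq_one_of_isOpen J
    (isOpen_compl_singleton (x := y)) hne
  obtain ⟨g, rfl⟩ := hF f
  have h0 : g (F y) = 0 := hf0 y (by simp)
  have h1 : g (F x) = 1 := hf1
  rw [hxy, h0] at h1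
  exact zero_ne_one h1

theorem isProperMap_of_surjective_smoothPullback [FiniteDimensional ℝ E] [T2Space M]
    {F : C^∞⟮J, N; I, M⟯}
    (hF : Function.Surjective (smoothPullback F)) : IsProperMap F := by
  have := Manifold.locallyCompact_of_finiteDimensional (M := M) I
  refine isProperMap_iff_isCompact_preimage.2 ⟨F.contMDiff.continuous, fun K hK => ?_⟩
  obtain ⟨h, hh⟩ := exists_contMDiffMap_isCompact_le J N
  obtain ⟨g, rfl⟩ := hF h
  obtain ⟨C, hC⟩ := hK.bddAbove_image g.contMDiff.continuous.continuousOn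
  exact (hh C).of_isClosed_subset (hK.isClosed.preimage F.contMDiff.continuous)
    fun x hx => hC (Set.mem_image_of_mem g hx)

end SurjectivePullback

/-- The image of a smooth map between vector spaces with a smooth left inverse can be flattened
by a local diffeomorphism. -/
theorem exists_openPartialHomeomorph_flatten {E E' : Type*} [NormedAddCommGroup E]
    [NormedSpace ℝ E] [CompleteSpace E] [NormedAddCommGroup E'] [NormedSpace ℝ E']
    {f : E' → E} {g : E → E'} {S : Set E'} {T : Set E} (hS : IsOpen S) (hT : IsOpen T)
    (hf : ContDiffOn ℝ ∞ f S) (hg : ContDiffOn ℝ ∞ g T) (hfT : ∀ u ∈ S, f u ∈ T)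
    (hgf : ∀ u ∈ S, g (f u) = u) {u₀ : E'} (hu₀ : u₀ ∈ S) :
    ∃ (e : OpenPartialHomeomorph E E) (A : E' →L[ℝ] E), Function.Injective A ∧
      f u₀ ∈ e.source ∧ ContDiffOn ℝ ∞ e e.source ∧ ContDiffOn ℝ ∞ e.symm e.target ∧
      (∀ z ∈ e.source, z ∈ T ∧ g z ∈ S ∧ (e z ∈ A.range → f (g z) = z)) ∧
      ∀ u ∈ S, e (f u) = A u := by
  set z₀ := f u₀ with hz₀
  have hgz₀ : g z₀ = u₀ := hgf u₀ hu₀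
  set A := fderiv ℝ f u₀
  set B := fderiv ℝ g z₀
  have hA : HasFDerivAt f A (g z₀) := by
    rw [hgz₀]
    exact ((hf.contDiffAt (hS.mem_nhds hu₀)).differentiableAt (by simp)).hasFDerivAt
  have hB : HasFDerivAt g B z₀ :=
    ((hg.contDiffAt (hT.mem_nhds (hfT u₀ hu₀))).differentiableAt (by simp)).hasFDerivAt
  have hBA : ∀ w, B (A w) = w := by
    have h1 : HasFDerivAt (g ∘ f) (B.comp A) u₀ := HasFDerivAt.comp u₀ hB (hgz₀ ▸ hA)
    have h2 : HasFDerivAt (g ∘ f) (ContinuousLinearMap.id ℝ E') u₀ :=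
      (hasFDerivAt_id u₀).congr_of_eventuallyEq (Filter.mem_of_superset (hS.mem_nhds hu₀) hgf)
    exact fun w => DFunLike.congr_fun (h1.unique h2) w
  set Θ : E → E := fun z => (z - f (g z)) - A (B (z - f (g z))) + A (g z) with hΘ
  have hT' : IsOpen (T ∩ g ⁻¹' S) := hg.continuousOn.isOpen_inter_preimage hT hS
  have hfg : ContDiffOn ℝ ∞ (fun z => f (g z)) (T ∩ g ⁻¹' S) :=
    hf.comp (hg.mono Set.inter_subset_left) fun z hz => hz.2
  have hr : ContDiffOn ℝ ∞ (fun z => z - f (g z)) (T ∩ g ⁻¹' S) := contDiffOn_id.sub hfg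
  have hΘsmooth : ContDiffOn ℝ ∞ Θ (T ∩ g ⁻¹' S) :=
    (hr.sub (A.contDiff.comp_contDiffOn (B.contDiff.comp_contDiffOn hr))).add
      (A.contDiff.comp_contDiffOn (hg.mono Set.inter_subset_left))
  have hΘ' : HasFDerivAt Θ ((ContinuousLinearEquiv.refl ℝ E : E ≃L[ℝ] E) : E →L[ℝ] E) z₀ := by
    have hr' := (hasFDerivAt_id z₀).sub (hA.comp z₀ hB)
    have h := (hr'.sub (A.hasFDerivAt.comp z₀ (B.hasFDerivAt.comp z₀ hr'))).add
      (A.hasFDerivAt.comp z₀ hB)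
    refine h.congr_fderiv ?_
    ext w
    simp [hBA]
  have hΘf : ∀ u ∈ S, Θ (f u) = A u := fun u hu => by simp [hΘ, hgf u hu]
  obtain ⟨e, hze, heT, hecoe, he, hesymm⟩ := exists_openPartialHomeomorph_of_hasFDerivAt_equiv hT'
    (a := z₀) ⟨hfT u₀ hu₀, by rwa [Set.mem_preimage, hgz₀]⟩ hΘsmooth hΘ'
  have hopen : IsOpen (e.source ∩ (fun z => f (g z)) ⁻¹' e.source) :=
    (hfg.continuousOn.mono heT).isOpen_inter_preimage e.open_source e.open_source
  refine ⟨e.restrOpen _ hopen, A, fun v w hvw => ?_, ?_, ?_, ?_, ?_, ?_⟩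
  · rw [← hBA v, hvw, hBA]
  · exact ⟨hze, hze, by rwa [Set.mem_preimage, hgz₀]⟩
  · exact he.mono fun z hz => hz.1
  · exact hesymm.mono fun z hz => hz.1
  · rintro z ⟨hz, -, hz'⟩
    refine ⟨(heT hz).1, (heT hz).2, fun ⟨w, hw⟩ => ?_⟩
    change A w = e z at hw
    have hw' : A w = Θ z := by rw [hw, hecoe]
    have hwz : w = g z := by
      have := congrArg B hw'
      simpa [hΘ, hBA] using this
    refine e.injOn hz' hz ?_
    rw [hecoe, hΘf _ (heT hz).2, ← hw', hwz]
  · intro u hu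
    change e (f u) = _
    rw [hecoe, hΘf u hu]

/-- Composing a chart with a local diffeomorphism of the model space gives a chart. -/
theorem exists_mem_maximalAtlas_comp {E : Type*} [NormedAddCommGroup E] [NormedSpace ℝ E]
    {H : Type*} [TopologicalSpace H] (I : ModelWithCorners ℝ E H) [I.Boundaryless]
    {M : Type*} [TopologicalSpace M] [ChartedSpace H M] [IsManifold I ∞ M]
    {c : OpenPartialHomeomorph M H} (hc : c ∈ IsManifold.maximalAtlas I ∞ M)
    (e : OpenPartialHomeomorph E E) (he : ContDiffOn ℝ ∞ e e.source)
    (hesymm : ContDiffOn ℝ ∞ e.symm e.target) :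
    ∃ ψ ∈ IsManifold.maximalAtlas I ∞ M,
      ψ.source = c.source ∩ {q | I (c q) ∈ e.source} ∧ ∀ q, I (ψ q) = e (I (c q)) := by
  have hI : ∀ z, I (I.symm z) = z := fun z => I.right_inv (by simp [I.range_eq_univ])
  let h : OpenPartialHomeomorph H E := I.toHomeomorph.toOpenPartialHomeomorph
  let e' : OpenPartialHomeomorph H H := (h.trans e).trans h.symm
  have he' : e' ∈ contDiffGroupoid ∞ I := by
    rw [contDiffGroupoid, mem_groupoid_of_pregroupoid]
    refine ⟨he.congr_mono (fun z _ => ?_) ?_, hesymm.congr_mono (fun z _ => ?_) ?_⟩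
    · change I (I.symm (e (I (I.symm z)))) = e z
      rw [hI, hI]
    · rintro z ⟨hz, -⟩
      simpa [e', h, ModelWithCorners.toHomeomorph, hI] using hz
    · change I (I.symm (e.symm (I (I.symm z)))) = e.symm z
      rw [hI, hI]
    · rintro z ⟨hz, -⟩
      simpa [e', h, ModelWithCorners.toHomeomorph, hI] using hz
  refine ⟨c.trans e', ?_, ?_, fun q => ?_⟩
  · refine (mem_maximalAtlas_iff).2 fun d hd => ⟨?_, ?_⟩
    · rw [OpenPartialHomeomorph.trans_symm_eq_symm_trans_symm, OpenPartialHomeomorph.trans_assoc]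
      exact (contDiffGroupoid ∞ I).trans ((contDiffGroupoid ∞ I).symm he')
        (((mem_maximalAtlas_iff).1 hc d hd).1)
    · rw [← OpenPartialHomeomorph.trans_assoc]
      exact (contDiffGroupoid ∞ I).trans (((mem_maximalAtlas_iff).1 hc d hd).2) he'
  · ext q
    simp [e', h, ModelWithCorners.toHomeomorph]
  · exact hI _

section Flattening

variable {E : Type*} [NormedAddCommGroup E] [NormedSpace ℝ E] [FiniteDimensional ℝ E]
  {H : Type*} [TopologicalSpace H] {I : ModelWithCorners ℝ E H} [I.Boundaryless]
  {M : Type*} [TopologicalSpace M] [ChartedSpace H M] [IsManifold I ∞ M]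
  {E' : Type*} [NormedAddCommGroup E'] [NormedSpace ℝ E'] [FiniteDimensional ℝ E']
  {H' : Type*} [TopologicalSpace H'] {J : ModelWithCorners ℝ E' H'} [J.Boundaryless]
  {N : Type*} [TopologicalSpace N] [ChartedSpace H' N] [T2Space N] [SigmaCompactSpace N]
  [IsManifold J ∞ N]

omit [FiniteDimensional ℝ E] [I.Boundaryless] [IsManifold I ∞ M] [J.Boundaryless] in
/-- If every smooth function on `N` is a pullback along `F`, then `F` has smooth left inverses in
charts. -/
theorem exists_leftInverse_of_surjective_smoothPullback {F : C^∞⟮J, N; I, M⟯}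
    (hF : Function.Surjective (smoothPullback F)) (y₀ : N) :
    ∃ G : M → E', ContMDiff I 𝓘(ℝ, E') ∞ G ∧ ∀ᶠ y in nhds y₀, G (F y) = extChartAt J y₀ y := by
  let e : E' ≃L[ℝ] (Fin (Module.finrank ℝ E') → ℝ) := (Module.finBasis ℝ E').equivFunL
  have hcoord : ∀ i, ∃ g : C^∞⟮I, M; ℝ⟯, ∀ᶠ y in nhds y₀, g (F y) = e (extChartAt J y₀ y) i := by
    intro i
    have hu : ContMDiffOn J 𝓘(ℝ) ∞ (fun x => e (extChartAt J y₀ x) i)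
        (chartAt H' y₀).source :=
      ((ContinuousLinearMap.proj (R := ℝ) (φ := fun _ => ℝ) i).contMDiff.comp
        e.contDiff.contMDiff).comp_contMDiffOn contMDiffOn_extChartAt
    obtain ⟨f, hf⟩ := exists_contMDiffMap_eventuallyEq_nhds J (chartAt H' y₀).open_source hu
      (mem_chart_source H' y₀)
    obtain ⟨g, rfl⟩ := hF f
    exact ⟨g, hf⟩
  choose g hg using hcoord
  refine ⟨fun x => e.symm fun i => g i x,
    e.symm.contDiff.contMDiff.comp (contMDiff_pi_space.2 fun i => (g i).contMDiff), ?_⟩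
  filter_upwards [Filter.eventually_all.2 hg] with y hy
  rw [ContinuousLinearEquiv.symm_apply_eq]
  exact funext hy

/-- If every smooth function on `N` is a pullback along the topological embedding `F`, then `F` is
a linear inclusion in suitable charts, and its image is flat in the chart of the target. -/
theorem exists_charts_of_surjective_smoothPullback {F : C^∞⟮J, N; I, M⟯}
    (hF : Function.Surjective (smoothPullback F)) (hemb : Topology.IsInducing F) (y₀ : N) :
    ∃ φ ∈ IsManifold.maximalAtlas J ∞ N, ∃ ψ ∈ IsManifold.maximalAtlas I ∞ M,
      ∃ A : E' →L[ℝ] E, Function.Injective A ∧ F y₀ ∈ ψ.source ∧ φ.source = F ⁻¹' ψ.source ∧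
      (∀ y ∈ φ.source, I (ψ (F y)) = A (J (φ y))) ∧
      ∀ q ∈ ψ.source, I (ψ q) ∈ A.range → q ∈ Set.range F := by
  obtain ⟨G, hG, hGF⟩ := exists_leftInverse_of_surjective_smoothPullback hF y₀
  obtain ⟨V, hVsub, hV, hyV⟩ := eventually_nhds_iff.1
    (hGF.and ((chartAt H' y₀).open_source.mem_nhds (mem_chart_source H' y₀)))
  obtain ⟨W, hW, hWV⟩ := hemb.isOpen_iff.1 hV
  set a := extChartAt J y₀
  set b := extChartAt I (F y₀)
  have hsource : ∀ q, q ∈ b.source ↔ q ∈ (chartAt H (F y₀)).source := fun q => by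
    rw [extChartAt_source]
  have haV : ∀ y ∈ V, y ∈ a.source := fun y hy => by
    rw [extChartAt_source]; exact (hVsub y hy).2
  set S : Set E' := a.target ∩ a.symm ⁻¹' (V ∩ F ⁻¹' (chartAt H (F y₀)).source)
  have hS : IsOpen S := (continuousOn_extChartAt_symm y₀).isOpen_inter_preimage
    (isOpen_extChartAt_target y₀)
    (hV.inter ((chartAt H (F y₀)).open_source.preimage F.contMDiff.continuous))
  have hT : IsOpen b.target := isOpen_extChartAt_target (F y₀)
  have hmem : ∀ y ∈ V, F y ∈ (chartAt H (F y₀)).source → a y ∈ S := fun y hy hFy =>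
    ⟨a.map_source (haV y hy), by
      rw [Set.mem_preimage, a.left_inv (haV y hy)]; exact ⟨hy, hFy⟩⟩
  have hf : ContDiffOn ℝ ∞ (fun u => b (F (a.symm u))) S := by
    rw [← contMDiffOn_iff_contDiffOn]
    exact (contMDiffOn_extChartAt (I := I) (x := F y₀) (n := ∞)).comp
      (F.contMDiff.comp_contMDiffOn ((contMDiffOn_extChartAt_symm y₀).mono Set.inter_subset_left))
      fun u hu => hu.2.2
  have hg : ContDiffOn ℝ ∞ (fun z => G (b.symm z)) b.target := by
    rw [← contMDiffOn_iff_contDiffOn]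
    exact hG.comp_contMDiffOn (contMDiffOn_extChartAt_symm (F y₀))
  obtain ⟨e, A, hA, hmem₀, he, hesymm, heS, hef⟩ := exists_openPartialHomeomorph_flatten hS hT hf hg
    (fun u hu => b.map_source ((hsource _).2 hu.2.2))
    (fun u hu => by
      rw [b.left_inv ((hsource _).2 hu.2.2), (hVsub _ hu.2.1).1, a.right_inv hu.1])
    (hmem y₀ hyV (mem_chart_source H (F y₀)))
  rw [a.left_inv (haV y₀ hyV)] at hmem₀
  obtain ⟨ψ₀, hψ₀, hψ₀source, hψ₀apply⟩ := exists_mem_maximalAtlas_comp I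
    (IsManifold.chart_mem_maximalAtlas (F y₀)) e he hesymm
  have hψsource : ∀ q, q ∈ (ψ₀.restr W).source ↔
      (q ∈ (chartAt H (F y₀)).source ∧ b q ∈ e.source) ∧ q ∈ W := fun q => by
    rw [ψ₀.restr_source' W hW, hψ₀source]; rfl
  have hpre : IsOpen (F ⁻¹' (ψ₀.restr W).source) :=
    (ψ₀.restr W).open_source.preimage F.contMDiff.continuous
  have hsub : ∀ y, F y ∈ (ψ₀.restr W).source → y ∈ V := fun y hy => by
    rw [← hWV]; exact ((hψsource _).1 hy).2
  have hyW : F y₀ ∈ W := by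
    have : y₀ ∈ F ⁻¹' W := hWV ▸ hyV
    exact this
  refine ⟨(chartAt H' y₀).restr (F ⁻¹' (ψ₀.restr W).source),
    restr_mem_maximalAtlas _ (IsManifold.chart_mem_maximalAtlas y₀) hpre,
    ψ₀.restr W, restr_mem_maximalAtlas _ hψ₀ hW, A, hA,
    (hψsource _).2 ⟨⟨mem_chart_source H (F y₀), hmem₀⟩, hyW⟩, ?_, ?_, ?_⟩
  · rw [OpenPartialHomeomorph.restr_source' _ _ hpre]
    exact Set.inter_eq_right.2 fun y hy => (hVsub y (hsub y hy)).2
  · intro y hy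
    rw [OpenPartialHomeomorph.restr_source' _ _ hpre] at hy
    have hyV := hsub y hy.2
    have hFy := ((hψsource _).1 hy.2).1.1
    have := hef (a y) (hmem y hyV hFy)
    rw [a.left_inv (haV y hyV)] at this
    exact (hψ₀apply (F y)).trans this
  · intro q hq hqA
    obtain ⟨⟨hq1, hq2⟩, -⟩ := (hψsource q).1 hq
    obtain ⟨-, hgS, hrange⟩ := heS (b q) hq2
    have hqA' : e (b q) ∈ A.range := by
      have : I (ψ₀ q) ∈ A.range := hqA
      rwa [hψ₀apply] at this
    exact ⟨_, b.injOn ((hsource _).2 hgS.2.2) ((hsource _).2 hq1) (hrange hqA')⟩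

theorem isEmbeddedSubmanifold_range_of_surjective_smoothPullback {F : C^∞⟮J, N; I, M⟯}
    (hF : Function.Surjective (smoothPullback F)) (hemb : Topology.IsInducing F) :
    IsEmbeddedSubmanifold I (Module.finrank ℝ E') (Set.range F) := by
  rintro _ ⟨y₀, rfl⟩
  obtain ⟨φ, -, ψ, hψ, A, hA, hy₀, hsource, hψF, hrange⟩ :=
    exists_charts_of_surjective_smoothPullback hF hemb y₀
  have hmem : ∀ y, F y ∈ ψ.source → I (ψ (F y)) ∈ A.range := fun y hy =>
    ⟨J (φ y), (hψF y (hsource ▸ hy)).symm⟩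
  refine ⟨ψ, hψ, hy₀, A.range, LinearMap.finrank_range_of_inj hA, fun q hq => ⟨?_, fun h => ?_⟩⟩
  · rintro ⟨y, rfl⟩
    exact sub_mem (hmem y hq) (hmem y₀ hy₀)
  · refine hrange q hq ?_
    simpa using add_mem h (hmem y₀ hy₀)

/-- An injective linear map extends to an isomorphism from a product with a space of complementary
dimension. -/
theorem exists_equiv_prod_of_injective {A : E' →L[ℝ] E} (hA : Function.Injective A) :
    ∃ L : (E' × (Fin (Module.finrank ℝ E - Module.finrank ℝ E') → ℝ)) ≃L[ℝ] E,
      ∀ u, L (u, 0) = A u := by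
  obtain ⟨Q, hQ⟩ := A.range.exists_isCompl
  have hAr : Module.finrank ℝ A.range = Module.finrank ℝ E' := LinearMap.finrank_range_of_inj hA
  have hdim := Submodule.finrank_add_eq_of_isCompl hQ
  have hQdim : Module.finrank ℝ (Fin (Module.finrank ℝ E - Module.finrank ℝ E') → ℝ) =
      Module.finrank ℝ Q := by
    rw [Module.finrank_fin_fun]
    omega
  let κ := LinearEquiv.ofFinrankEq (R := ℝ) _ _ hQdim
  let L := ((LinearEquiv.ofInjective (A : E' →ₗ[ℝ] E) hA).prodCongr κ).trans
    (Submodule.prodEquivOfIsCompl _ _ hQ)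
  refine ⟨L.toContinuousLinearEquiv, fun u => ?_⟩
  change L (u, 0) = A u
  simp [L]

theorem isSmoothEmbedding_of_surjective_smoothPullback {F : C^∞⟮J, N; I, M⟯}
    (hF : Function.Surjective (smoothPullback F)) (hemb : Topology.IsEmbedding F) :
    Manifold.IsSmoothEmbedding J I ∞ F := by
  refine ⟨Manifold.IsImmersionOfComplement.isImmersion
    (F := Fin (Module.finrank ℝ E - Module.finrank ℝ E') → ℝ) fun y₀ => ?_, hemb⟩
  obtain ⟨φ, hφ, ψ, hψ, A, hA, hy₀, hsource, hψF, -⟩ :=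
    exists_charts_of_surjective_smoothPullback hF hemb.isInducing y₀
  obtain ⟨L, hL⟩ := exists_equiv_prod_of_injective hA
  refine Manifold.IsImmersionAtOfComplement.mk_of_charts L φ ψ (hsource ▸ hy₀) hy₀ hφ hψ
    hsource.subset fun u hu => ?_
  have hu' : (φ.extend J).symm u ∈ φ.source := by
    simpa using (φ.extend J).map_target hu
  change I (ψ (F ((φ.extend J).symm u))) = L (u, 0)
  rw [hψF _ hu', hL]
  exact congrArg A ((φ.extend J).right_inv hu)

end Flattening

section PointDerivations

open Set Filter Topology

variable {E : Type*} [NormedAddCommGroup E] [NormedSpace ℝ E] [FiniteDimensional ℝ E]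
  {H : Type*} [TopologicalSpace H] {I : ModelWithCorners ℝ E H}
  {M : Type*} [TopologicalSpace M] [T2Space M] [SigmaCompactSpace M]
  [ChartedSpace H M] [IsManifold I ∞ M]

/-- Derivations at a point depend only on germs. -/
theorem pointDerivation_congr {v : C^∞⟮I, M; ℝ⟯ →ₗ[ℝ] ℝ} {p : M}
    (hv : ∀ f g, v (f * g) = f p * v g + g p * v f) {f g : C^∞⟮I, M; ℝ⟯}
    (hfg : ∀ᶠ q in 𝓝 p, f q = g q) : v f = v g := by
  obtain ⟨U, hU, hUo, hpU⟩ := eventually_nhds_iff.1 hfg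
  obtain ⟨b, hb1, -, hb0⟩ := exists_contMDiffMap_eq_one_of_isOpen I hUo hpU
  have hzero : b * (f - g) = 0 := by
    ext q
    change b q * (f q - g q) = 0
    by_cases hq : q ∈ U
    · rw [hU q hq, sub_self, mul_zero]
    · rw [hb0 q hq, zero_mul]
  have h := hv b (f - g)
  have hp : (f - g) p = 0 := sub_eq_zero.2 (hU p hpU)
  rw [hzero, map_zero, hb1, hp, zero_mul, add_zero, one_mul, map_sub] at h
  exact (sub_eq_zero.1 h.symm)

variable [I.Boundaryless]

/-- Derivations at a point are directional derivatives in charts. -/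
theorem pointDerivation_eq_fderiv {v : C^∞⟮I, M; ℝ⟯ →ₗ[ℝ] ℝ} {p : M}
    (hv : ∀ f g, v (f * g) = f p * v g + g p * v f) {ι : Type*} [Fintype ι]
    (β : Module.Basis ι ℝ E) {c : M} (hp : p ∈ (chartAt H c).source) {x : ι → C^∞⟮I, M; ℝ⟯}
    (hx : ∀ j, ∀ᶠ q in 𝓝 p, x j q = β.repr (extChartAt I c q) j) (f : C^∞⟮I, M; ℝ⟯) :
    v f = fderiv ℝ (f ∘ (extChartAt I c).symm) (extChartAt I c p) (∑ j, v (x j) • β j) := by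
  set a := extChartAt I c
  have hpa : p ∈ a.source := by rwa [extChartAt_source]
  have haev : ∀ᶠ q in 𝓝 p, q ∈ a.source := extChartAt_source_mem_nhds' hpa
  have hacont : ContinuousAt a p := continuousAt_extChartAt' hpa
  obtain ⟨g, hg⟩ := exists_contMDiffMap_eventuallyEq_nhds 𝓘(ℝ, E) (p := a p)
    (isOpen_extChartAt_target c)
    (f.contMDiff.comp_contMDiffOn (contMDiffOn_extChartAt_symm c)) (a.map_source hpa)
  obtain ⟨h, hh, hhp, hgh⟩ :=
    (contMDiff_iff_contDiff.1 g.contMDiff).exists_eq_add_sum_smooth_mul β (a p)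
  have hk : ∀ j, ∃ k : C^∞⟮I, M; ℝ⟯, ∀ᶠ q in 𝓝 p, k q = h j (a q) := fun j =>
    exists_contMDiffMap_eventuallyEq_nhds I (chartAt H c).open_source
      ((hh j).contMDiff.comp_contMDiffOn contMDiffOn_extChartAt) hp
  choose k hk using hk
  let C : ℝ → C^∞⟮I, M; ℝ⟯ := algebraMap ℝ _
  have hC : ∀ r, v (C r) = 0 := fun r => by
    have h1 : v 1 = 0 := by
      have := hv 1 1
      simp only [mul_one] at this
      have h1p : (1 : C^∞⟮I, M; ℝ⟯) p = 1 := rfl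
      rw [h1p] at this
      linarith
    have : C r = r • 1 := Algebra.algebraMap_eq_smul_one r
    rw [this, map_smul, h1, smul_zero]
  have hxp : ∀ j, x j p = β.repr (a p) j := fun j => (hx j).self_of_nhds
  have hexp : ∀ᶠ q in 𝓝 p, f q = (C (g (a p)) + ∑ j, (x j - C (x j p)) * k j) q := by
    filter_upwards [haev, hacont.eventually hg, eventually_all.2 hk, eventually_all.2 hx]
      with q hqa hqg hqk hqx
    have hev : (C (g (a p)) + ∑ j, (x j - C (x j p)) * k j) q =
        g (a p) + ∑ j, (x j q - x j p) * k j q := by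
      have hw : ∀ w : C^∞⟮I, M; ℝ⟯, w q = (ContMDiffMap.evalRingHom q : C^∞⟮I, M; ℝ⟯ →+* ℝ) w :=
        fun _ => rfl
      refine (hw _).trans ?_
      simp only [map_add, map_sum, map_mul, map_sub]
      rfl
    rw [hev]
    have hfq : f q = g (a q) := by
      rw [hqg]
      exact congrArg f (a.left_inv hqa).symm
    rw [hfq, hgh]
    congr 1
    refine Finset.sum_congr rfl fun j _ => ?_
    rw [hqx j, hxp, hqk j, map_sub, Finsupp.sub_apply]
  have hterm : ∀ j, v ((x j - C (x j p)) * k j) = fderiv ℝ g (a p) (β j) * v (x j) := fun j => by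
    have h0 : (x j - C (x j p)) p = 0 := sub_self (x j p)
    rw [hv, h0, zero_mul, zero_add, map_sub, hC, sub_zero, (hk j).self_of_nhds, hhp]
  have hgf : fderiv ℝ g (a p) = fderiv ℝ (f ∘ a.symm) (a p) := EventuallyEq.fderiv_eq hg
  rw [pointDerivation_congr hv hexp, map_add, hC, zero_add, map_sum, ← hgf, map_sum]
  refine Finset.sum_congr rfl fun j _ => ?_
  rw [hterm, map_smul, smul_eq_mul, mul_comm]

end PointDerivations

section LocallyFiniteSum

open Set

variable {E : Type*} [NormedAddCommGroup E] [NormedSpace ℝ E]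
  {H : Type*} [TopologicalSpace H] {I : ModelWithCorners ℝ E H} [I.Boundaryless]
  {M : Type*} [TopologicalSpace M] [ChartedSpace H M] [IsManifold I ∞ M]

omit [I.Boundaryless] in
theorem contDiffOn_comp_extChartAt_symm (f : C^∞⟮I, M; ℝ⟯) (c : M) :
    ContDiffOn ℝ ∞ (f ∘ (extChartAt I c).symm) (extChartAt I c).target :=
  contMDiffOn_iff_contDiffOn.1 (f.contMDiff.comp_contMDiffOn (contMDiffOn_extChartAt_symm c))

theorem differentiableAt_comp_extChartAt_symm (f : C^∞⟮I, M; ℝ⟯) {c q : M}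
    (hq : q ∈ (chartAt H c).source) :
    DifferentiableAt ℝ (f ∘ (extChartAt I c).symm) (extChartAt I c q) :=
  ((contDiffOn_comp_extChartAt_symm f c).contDiffAt ((isOpen_extChartAt_target c).mem_nhds
    ((extChartAt I c).map_source (by rwa [extChartAt_source])))).differentiableAt (by simp)

theorem contMDiffOn_fderiv_comp_extChartAt_symm (f : C^∞⟮I, M; ℝ⟯) (c : M) {X : M → E}
    (hX : ContMDiff I 𝓘(ℝ, E) ∞ X) :
    ContMDiffOn I 𝓘(ℝ) ∞
      (fun q => fderiv ℝ (f ∘ (extChartAt I c).symm) (extChartAt I c q) (X q))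
      (chartAt H c).source := by
  have h : ContMDiffOn 𝓘(ℝ, E) 𝓘(ℝ, E →L[ℝ] ℝ) ∞ (fderiv ℝ (f ∘ (extChartAt I c).symm))
      (extChartAt I c).target :=
    ((contDiffOn_comp_extChartAt_symm f c).fderiv_of_isOpen (isOpen_extChartAt_target c)
      (by simp)).contMDiffOn
  exact (h.comp contMDiffOn_extChartAt fun q hq =>
    (extChartAt I c).map_source (by rwa [extChartAt_source])).clm_apply hX.contMDiffOn

/-- The derivation given by the vector field `∑ᵢ ρᵢ Xᵢ`, where `Xᵢ` is a vector field written in the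
chart at `i`. -/
theorem exists_derivation_eq_finsum
    {ρ : SmoothPartitionOfUnity M I M univ} (hρ : ρ.IsSubordinate fun c => (chartAt H c).source)
    {X : M → M → E} (hX : ∀ c, ContMDiff I 𝓘(ℝ, E) ∞ (X c)) :
    ∃ D : Derivation ℝ C^∞⟮I, M; ℝ⟯ C^∞⟮I, M; ℝ⟯, ∀ f q, D f q =
      ∑ c ∈ ρ.finsupport q, ρ c q *
        fderiv ℝ (f ∘ (extChartAt I c).symm) (extChartAt I c q) (X c q) := by
  let φ : C^∞⟮I, M; ℝ⟯ → M → M → ℝ := fun f c q =>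
    fderiv ℝ (f ∘ (extChartAt I c).symm) (extChartAt I c q) (X c q)
  have hsum : ∀ f q, ∑ᶠ c, ρ c q • φ f c q = ∑ c ∈ ρ.finsupport q, ρ c q * φ f c q := fun f q =>
    (ρ.sum_finsupport_smul_eq_finsum q (φ f)).symm
  have hsource : ∀ q, ∀ c ∈ ρ.finsupport q, q ∈ (chartAt H c).source := fun q c hc =>
    hρ c (subset_tsupport _ ((ρ.mem_finsupport q).1 hc))
  have hadd : ∀ f g q, ∀ c ∈ ρ.finsupport q, φ (f + g) c q = φ f c q + φ g c q :=
    fun f g q c hc => by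
      have := fderiv_add (differentiableAt_comp_extChartAt_symm f (hsource q c hc))
        (differentiableAt_comp_extChartAt_symm g (hsource q c hc))
      exact DFunLike.congr_fun this (X c q)
  have hsmul : ∀ (r : ℝ) f q, ∀ c ∈ ρ.finsupport q, φ (r • f) c q = r * φ f c q :=
    fun r f q c hc => by
      have := fderiv_const_smul (differentiableAt_comp_extChartAt_symm f (hsource q c hc)) r
      exact DFunLike.congr_fun this (X c q)
  have hmul : ∀ f g q, ∀ c ∈ ρ.finsupport q, φ (f * g) c q = f q * φ g c q + g q * φ f c q :=
    fun f g q c hc => by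
      have := fderiv_mul (differentiableAt_comp_extChartAt_symm f (hsource q c hc))
        (differentiableAt_comp_extChartAt_symm g (hsource q c hc))
      have h := DFunLike.congr_fun this (X c q)
      have hq : (extChartAt I c).symm (extChartAt I c q) = q :=
        (extChartAt I c).left_inv (by rw [extChartAt_source]; exact hsource q c hc)
      simp only [Function.comp_apply, hq] at h
      exact h
  let D₀ : C^∞⟮I, M; ℝ⟯ → C^∞⟮I, M; ℝ⟯ := fun f => ⟨fun q => ∑ᶠ c, ρ c q • φ f c q,
    ρ.contMDiff_finsum_smul (n := ⊤) fun c q hq =>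
      (contMDiffOn_fderiv_comp_extChartAt_symm f c (hX c)).contMDiffAt
        ((chartAt H c).open_source.mem_nhds (hρ c hq))⟩
  have hD₀ : ∀ f q, D₀ f q = ∑ c ∈ ρ.finsupport q, ρ c q * φ f c q := hsum
  refine ⟨Derivation.mk' ⟨⟨D₀, fun f g => ?_⟩, fun r f => ?_⟩ fun f g => ?_, hD₀⟩
  · ext q
    change D₀ (f + g) q = D₀ f q + D₀ g q
    rw [hD₀, hD₀, hD₀, ← Finset.sum_add_distrib]
    exact Finset.sum_congr rfl fun c hc => by rw [hadd f g q c hc, mul_add]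
  · ext q
    change D₀ (r • f) q = r * D₀ f q
    rw [hD₀, hD₀, Finset.mul_sum]
    exact Finset.sum_congr rfl fun c hc => by rw [hsmul r f q c hc, mul_left_comm]
  · ext q
    change D₀ (f * g) q = f q * D₀ g q + g q * D₀ f q
    rw [hD₀, hD₀, hD₀, Finset.mul_sum, Finset.mul_sum, ← Finset.sum_add_distrib]
    exact Finset.sum_congr rfl fun c hc => by rw [hmul f g q c hc]; ring

end LocallyFiniteSum

section Coembedding

open Set

variable {E : Type*} [NormedAddCommGroup E] [NormedSpace ℝ E] [FiniteDimensional ℝ E]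
  {H : Type*} [TopologicalSpace H] {I : ModelWithCorners ℝ E H} [I.Boundaryless]
  {M : Type*} [TopologicalSpace M] [T2Space M] [SigmaCompactSpace M]
  [ChartedSpace H M] [IsManifold I ∞ M]
  {E' : Type*} [NormedAddCommGroup E'] [NormedSpace ℝ E'] {H' : Type*} [TopologicalSpace H']
  {J : ModelWithCorners ℝ E' H'} {N : Type*} [TopologicalSpace N] [ChartedSpace H' N]

/-- Derivations lift along surjective pullbacks. -/
theorem exists_derivation_smoothPullback_apply_eq {F : C^∞⟮J, N; I, M⟯}
    (hF : Function.Surjective (smoothPullback F))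
    (D' : Derivation ℝ C^∞⟮J, N; ℝ⟯ C^∞⟮J, N; ℝ⟯) :
    ∃ D : Derivation ℝ C^∞⟮I, M; ℝ⟯ C^∞⟮I, M; ℝ⟯,
      ∀ f, smoothPullback F (D f) = D' (smoothPullback F f) := by
  let β := Module.finBasis ℝ E
  obtain ⟨ρ, hρ⟩ := SmoothPartitionOfUnity.exists_isSubordinate_chartAt_source I M
  have hx : ∀ (c : M) j, ∃ x : C^∞⟮I, M; ℝ⟯,
      ∀ᶠ q in nhdsSet (tsupport (ρ c)), x q = β.repr (extChartAt I c q) j := fun c j =>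
    exists_contMDiffMap_eventuallyEq_nhdsSet I (chartAt H c).open_source (isClosed_tsupport _)
      (hρ c) ((LinearMap.toContinuousLinearMap (β.coord j)).contMDiff.comp_contMDiffOn
        contMDiffOn_extChartAt)
  choose x hx using hx
  have hC : ∀ c j, ∃ g, smoothPullback F g = D' (smoothPullback F (x c j)) := fun c j => hF _
  choose g hg using hC
  have hX : ∀ c, ContMDiff I 𝓘(ℝ, E) ∞ fun q => ∑ j, g c j q • β j := fun c =>
    contMDiff_finsetSum fun j _ => (g c j).contMDiff.smul contMDiff_const
  obtain ⟨D, hD⟩ := exists_derivation_eq_finsum hρ hX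
  refine ⟨D, fun f => ?_⟩
  ext y
  change D f (F y) = _
  let v : C^∞⟮I, M; ℝ⟯ →ₗ[ℝ] ℝ :=
    { toFun := fun f => D' (smoothPullback F f) y
      map_add' := fun f g => by rw [map_add, map_add]; rfl
      map_smul' := fun r f => by rw [map_smul, Derivation.map_smul]; rfl }
  have hv : ∀ f g, v (f * g) = f (F y) * v g + g (F y) * v f := fun f g => by
    change D' (smoothPullback F (f * g)) y = _
    rw [map_mul, Derivation.leibniz]
    rfl
  rw [hD]
  have hterm : ∀ c ∈ ρ.finsupport (F y),
      ρ c (F y) * fderiv ℝ (f ∘ (extChartAt I c).symm) (extChartAt I c (F y))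
        (∑ j, g c j (F y) • β j) = ρ c (F y) * v f := fun c hc => by
    have hmem : F y ∈ tsupport (ρ c) := subset_tsupport _ ((ρ.mem_finsupport _).1 hc)
    rw [pointDerivation_eq_fderiv hv β (hρ c hmem)
      (fun j => (hx c j).filter_mono (nhds_le_nhdsSet hmem)) f]
    have hgv : ∀ j, g c j (F y) = v (x c j) := fun j => DFunLike.congr_fun (hg c j) y
    simp only [hgv]
  rw [Finset.sum_congr rfl hterm, ← Finset.sum_mul, ρ.sum_finsupport _ (mem_univ _), one_mul]
  rfl

theorem isCoembedding_smoothPullback {F : C^∞⟮J, N; I, M⟯}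
    (hF : Function.Surjective (smoothPullback F)) : IsCoembedding (smoothPullback F) := by
  refine ⟨hF, fun D' => ?_⟩
  obtain ⟨D, hD⟩ := exists_derivation_smoothPullback_apply_eq hF D'
  refine ⟨⟨D, fun a ha => ?_⟩, ?_⟩
  · rw [RingHom.mem_ker] at ha ⊢
    rw [hD, ha, map_zero]
  · ext1 b
    obtain ⟨a, rfl⟩ := hF b
    rw [pushDerivation_apply, hD]

end Coembedding

theorem theorem3p5
    {E : Type*} [NormedAddCommGroup E] [NormedSpace ℝ E] [FiniteDimensional ℝ E]
    {H : Type*} [TopologicalSpace H] (I : ModelWithCorners ℝ E H) [I.Boundaryless]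
    {M : Type*} [TopologicalSpace M] [T2Space M] [SecondCountableTopology M]
    [ChartedSpace H M] [IsManifold I ∞ M]
    {E' : Type*} [NormedAddCommGroup E'] [NormedSpace ℝ E'] [FiniteDimensional ℝ E']
    {H' : Type*} [TopologicalSpace H'] (J : ModelWithCorners ℝ E' H') [J.Boundaryless]
    {N : Type*} [TopologicalSpace N] [T2Space N] [SecondCountableTopology N]
    [ChartedSpace H' N] [IsManifold J ∞ N]
    (π : C^∞⟮I, M; ℝ⟯ →ₐ[ℝ] C^∞⟮J, N; ℝ⟯) (hπ : Function.Surjective π) :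
    (∃ F : C^∞⟮J, N; I, M⟯, π = smoothPullback F ∧
      Manifold.IsSmoothEmbedding J I ∞ F ∧ IsProperMap F ∧
      IsClosed (Set.range F) ∧
      IsEmbeddedSubmanifold I (Module.finrank ℝ E') (Set.range F)) ∧
    IsCoembedding π := by
  have := Manifold.locallyCompact_of_finiteDimensional (M := M) I
  have := Manifold.locallyCompact_of_finiteDimensional (M := N) J
  obtain ⟨F, rfl⟩ := exists_eq_smoothPullback π
  have hproper := isProperMap_of_surjective_smoothPullback hπ
  have hclosed : Topology.IsClosedEmbedding F :=
    .of_continuous_injective_isClosedMap hproper.continuous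
      (injective_of_surjective_smoothPullback hπ) hproper.isClosedMap
  exact ⟨⟨F, rfl, isSmoothEmbedding_of_surjective_smoothPullback hπ hclosed.isEmbedding, hproper,
    hclosed.isClosed_range,
    isEmbeddedSubmanifold_range_of_surjective_smoothPullback hπ hclosed.isInducing⟩,
    isCoembedding_smoothPullback hπ⟩
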